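/- Let $\mathcal M$ be a regular matroid on a finite ground set $E$, represented over $\mathbb R$ by a totally unimodular matrix $M$ with columns indexed by $E$. A signed circuit is a $\{0,\pm1\}$-vector in $\ker_{\mathbb R}(M)$ whose support is a circuit of $\mathcal M$. A signed cocircuit is a $\{0,\pm1\}$-vector in $\operatorname{im}_{\mathbb R}(M^T)$ whose support is a cocircuit of $\mathcal M$. Each edge $e\in E$ has two arcs, $+\vec e$ and $-\vec e$. A signed circuit or cocircuit $x$ is identified with the set of arcs consisting of $+\vec e$ for each $e$ with $x_e=1$ and $-\vec e$ for each $e$ with $x_e=-1$. An orientation of $\mathcal M$ is a set of arcs containing exactly one arc of each edge. A circuit signature $\sigma$ chooses for each circuit $C$ a signed circuit $\sigma(C)$ with support $C$. A cocircuit signature $\sigma^*$ chooses for each cocircuit $C^*$ a signed cocircuit $\sigma^*(C^*)$ with support $C^*$. We write $x\in\sigma$ if $x=\sigma(C)$ for some circuit $C$, and similarly for $\sigma^*$. For a basis $B$: - Let $\overrightarrow B$ be the set of arcs that contains both arcs of each $e\in B$ and, for each $e\notin B$, exactly the arc of $e$ that lies in $\sigma(C(B,e))$, where $C(B,e)$ is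 the unique circuit contained in $B\cup\{e\}$. - Let $\overrightarrow{B^*}$ be the set of arcs that contains both arcs of each $e\notin B$ and, for each $e\in B$, exactly the arc of $e$ that lies in $\sigma^*(C^*(B,e))$, where $C^*(B,e)$ is the unique cocircuit contained in $(E\setminus B)\cup\{e\}$. Put $\mathrm{BBY}_{\sigma,\sigma^*}(B)=\overrightarrow B\cap\overrightarrow{B^*}$. The signature $\sigma$ is triangulating if, for every basis $B$, every signed circuit contained in $\overrightarrow B$ is in $\sigma$. The signature $\sigma^*$ is triangulating if, for every basis $B$, every signed cocircuit contained in $\overrightarrow{B^*}$ is in $\sigma^*$. An orientation is $(\sigma,\sigma^*)$-compatible if every signed circuit contained in it is in $\sigma$ and every signed cocircuit contained in it is in $\sigma^*$. **Theorem.** If $\sigma$ is a triangulating circuit signature and $\sigma^*$ is a triangulating cocircuit signature of $\mathcal M$, then $B\mapsto \mathrm{BBY}_{\sigma,\sigma^*}(B)$ is a bijection from the set of bases of $\mathcal M$ onto the set of $(\sigma,\sigma^*)$-compatible orientations of $\mathcal M$. -/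

import Mathlib

namespace RegularMatroid

variable {E R : Type*} [Fintype E] [Fintype R]

/-- The real matrix `A`, with columns indexed by the (whole) ground set `E`, represents the
matroid `M`: a set of edges is independent in `M` iff the corresponding family of columns of `A`
is linearly independent over `ℝ`. -/
def Represents (A : Matrix R E ℝ) (M : Matroid E) : Prop :=
  M.E = Set.univ ∧ ∀ I : Set E, M.Indep I ↔ LinearIndepOn ℝ (fun e : E => A.col e) I

/-- A signed circuit of `M` (with respect to the representing matrix `A`): a `{0, 1, -1}`-vector
in the kernel of `A` whose support is a circuit of `M`. -/
def IsSignedCircuit (M : Matroid E) (A : Matrix R E ℝ) (x : E → ℝ) : Prop :=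
  (∀ e, x e = 0 ∨ x e = 1 ∨ x e = -1) ∧ A.mulVec x = 0 ∧ M.IsCircuit (Function.support x)

/-- A signed cocircuit of `M` (with respect to the representing matrix `A`): a
`{0, 1, -1}`-vector in the image of the transpose of `A` whose support is a cocircuit of `M`. -/
def IsSignedCocircuit (M : Matroid E) (A : Matrix R E ℝ) (x : E → ℝ) : Prop :=
  (∀ e, x e = 0 ∨ x e = 1 ∨ x e = -1) ∧ (∃ y : R → ℝ, A.transpose.mulVec y = x) ∧
    M.IsCocircuit (Function.support x)

/-- A circuit signature: the choice of a signed circuit `σ(C)` supported on each circuit `C`. -/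
structure CircuitSignature (M : Matroid E) (A : Matrix R E ℝ) where
  /-- the signed circuit `σ(C)` chosen for the circuit `C` -/
  choice : {C : Set E // M.IsCircuit C} → E → ℝ
  isSignedCircuit : ∀ C, IsSignedCircuit M A (choice C)
  support_eq : ∀ C, Function.support (choice C) = C.1

/-- A cocircuit signature: the choice of a signed cocircuit `σ*(D)` supported on each
cocircuit `D`. -/
structure CocircuitSignature (M : Matroid E) (A : Matrix R E ℝ) where
  /-- the signed cocircuit `σ*(D)` chosen for the cocircuit `D` -/
  choice : {D : Set E // M.IsCocircuit D} → E → ℝ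
  isSignedCocircuit : ∀ D, IsSignedCocircuit M A (choice D)
  support_eq : ∀ D, Function.support (choice D) = D.1

/-- An arc: an edge together with one of its two directions, `1` or `-1`. -/
abbrev Arc (E : Type*) := E × ℤˣ

/-- The set of arcs of a `{0, 1, -1}`-vector. -/
def arcs (x : E → ℝ) : Set (Arc E) := {a | x a.1 = ((a.2 : ℤ) : ℝ)}

/-- An orientation: a set of arcs in which each edge appears exactly once. -/
def IsOrientation (O : Set (Arc E)) : Prop := ∀ e : E, ∃! s : ℤˣ, (e, s) ∈ O

variable {M : Matroid E} {A : Matrix R E ℝ}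

/-- The externally oriented basis attached to the basis `B` in the external atlas of `σ`: each
edge in `B` is bioriented, and each edge `e ∉ B` is oriented as in `σ(C)`, where `C` is the
fundamental circuit of `e` with respect to `B`. -/
def CircuitSignature.externalBasis (σ : CircuitSignature M A) (B : Set E) : Set (Arc E) :=
  {a | a.1 ∈ B ∨ (a.1 ∉ B ∧ ∃ C : {C : Set E // M.IsCircuit C},
    C.1 = M.fundCircuit a.1 B ∧ a ∈ arcs (σ.choice C))}

/-- The internally oriented basis attached to the basis `B` in the internal atlas of `σ'`: each
edge not in `B` is bioriented, and each edge `e ∈ B` is oriented as in `σ'(D)`, where `D` is the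
fundamental cocircuit of `e` with respect to `B`. -/
def CocircuitSignature.internalBasis (σ' : CocircuitSignature M A) (B : Set E) : Set (Arc E) :=
  {a | a.1 ∉ B ∨ (a.1 ∈ B ∧ ∃ D : {D : Set E // M.IsCocircuit D},
    D.1 = M.fundCocircuit a.1 B ∧ a ∈ arcs (σ'.choice D))}

/-- A circuit signature is triangulating if every signed circuit contained in one of the
externally oriented bases of its atlas belongs to the signature. -/
def CircuitSignature.IsTriangulating (σ : CircuitSignature M A) : Prop :=
  ∀ B : Set E, M.IsBase B → ∀ x : E → ℝ, IsSignedCircuit M A x →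
    arcs x ⊆ σ.externalBasis B → x ∈ Set.range σ.choice

/-- A cocircuit signature is triangulating if every signed cocircuit contained in one of the
internally oriented bases of its atlas belongs to the signature. -/
def CocircuitSignature.IsTriangulating (σ' : CocircuitSignature M A) : Prop :=
  ∀ B : Set E, M.IsBase B → ∀ x : E → ℝ, IsSignedCocircuit M A x →
    arcs x ⊆ σ'.internalBasis B → x ∈ Set.range σ'.choice

/-- `O` is `σ`-compatible: every signed circuit in `O` belongs to `σ`. -/
def CircuitSignature.Compatible (σ : CircuitSignature M A) (O : Set (Arc E)) : Prop :=
  ∀ x : E → ℝ, IsSignedCircuit M A x → arcs x ⊆ O → x ∈ Set.range σ.choice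

/-- `O` is `σ'`-compatible: every signed cocircuit in `O` belongs to `σ'`. -/
def CocircuitSignature.Compatible (σ' : CocircuitSignature M A) (O : Set (Arc E)) : Prop :=
  ∀ x : E → ℝ, IsSignedCocircuit M A x → arcs x ⊆ O → x ∈ Set.range σ'.choice

/-- The map `BBY` of a pair of signatures: it sends a basis to the intersection of its externally
oriented and its internally oriented version. -/
def BBY (σ : CircuitSignature M A) (σ' : CocircuitSignature M A) (B : Set E) : Set (Arc E) :=
  σ.externalBasis B ∩ σ'.internalBasis B

end RegularMatroid

/-! The triangulating hypotheses say directly that BBY orientations are compatible. Bijectivity then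
follows from injectivity together with the bound that there are at most as many compatible
orientations as bases.

Injectivity (`BBY_injOn`): suppose two different bases give the same orientation. A Gordan
alternative (`exists_mem_or_exists_orthogonal`) produces a nonzero cycle or cocycle with prescribed
signs on the symmetric difference of the bases. By `exists_conformal` it may be replaced by a signed
circuit or cocircuit `c`. The signs are chosen so that `c` fits the atlas of one basis and `-c` that
of the other, so the signature contains both, which is absurd.

Counting (`ncard_compatible_le`): let `D` be the matrix of fundamental cocircuits of a basis. The
cokernel of `D * D.transpose` has order equal to its determinant, which by Cauchy–Binet is the
number of bases. Compatible orientations have distinct classes there (`compatible_injOn`): if two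
classes agree, the difference of the orientations is an integral cycle plus an integral cocycle,
with disjoint supports. A nonzero summand contains a conformal signed circuit or cocircuit lying in
one orientation, with its negative in the other. -/

namespace RegularMatroid

/-! ### Conformal vectors and a theorem of the alternative -/

section Conformal

variable {E : Type*} [Fintype E]

/-- If every nonzero vector of the subspace `V` contains the support of a member of `S ⊆ V`, then
every nonzero vector of `V` even has a member of `S` conformal to it. -/
theorem exists_conformal (V : Submodule ℝ (E → ℝ)) (S : Set (E → ℝ))
    (hneg : ∀ x ∈ S, -x ∈ S) (hne : ∀ x ∈ S, x ≠ 0) (hSV : ∀ x ∈ S, x ∈ V)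
    (hS : ∀ u ∈ V, u ≠ 0 → ∃ x ∈ S, Function.support x ⊆ Function.support u)
    (u : E → ℝ) (hu : u ∈ V) (hu0 : u ≠ 0) :
    ∃ x ∈ S, ∀ e, x e ≠ 0 → 0 < x e * u e := by
  induction hn : (Function.support u).ncard using Nat.strong_induction_on generalizing u with
  | _ n ih =>
  subst hn
  obtain ⟨x, hxS, hxu⟩ := hS u hu hu0
  -- The minimal ratio gives a multiple `t • x` that cancels `u` at `e₀` and is nowhere larger than
  -- `u` in absolute value.
  obtain ⟨e₀, he₀, hmin⟩ := Set.exists_min_image (Function.support x) (fun e => |u e| / |x e|)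
    (Set.toFinite _) (Function.support_nonempty_iff.2 (hne x hxS))
  have hx₀ : x e₀ ≠ 0 := he₀
  set t := u e₀ / x e₀ with ht
  have ht0 : t ≠ 0 := div_ne_zero (hxu he₀) hx₀
  have hle : ∀ e, |t * x e| ≤ |u e| := by
    intro e
    by_cases hxe : x e = 0
    · simp [hxe]
    · have := hmin e hxe
      rw [abs_mul, ht, abs_div]
      exact (le_div_iff₀ (abs_pos.2 hxe)).1 this
  by_cases hw : u - t • x = 0
  · have hux : u = t • x := sub_eq_zero.1 hw
    rcases lt_or_gt_of_ne ht0 with h | h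
    · refine ⟨-x, hneg x hxS, fun e he => ?_⟩
      have he' : x e ≠ 0 := by simpa using he
      rw [hux]
      have : 0 < x e * x e := mul_self_pos.2 he'
      simp only [Pi.neg_apply, Pi.smul_apply, smul_eq_mul]
      nlinarith
    · refine ⟨x, hxS, fun e he => ?_⟩
      rw [hux]
      have : 0 < x e * x e := mul_self_pos.2 he
      simp only [Pi.smul_apply, smul_eq_mul]
      nlinarith
  · have hsub : Function.support (u - t • x) ⊂ Function.support u := by
      refine Set.ssubset_iff_subset_ne.2 ⟨fun e he hue => he ?_, fun h => ?_⟩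
      · have hue : u e = 0 := by simpa using hue
        have hxe : x e = 0 := by
          by_contra hxe
          exact hxu hxe hue
        simp [hue, hxe]
      · have : e₀ ∈ Function.support (u - t • x) := h ▸ hxu he₀
        apply this
        simp [ht, hx₀]
    obtain ⟨y, hyS, hy⟩ := ih _ (Set.ncard_lt_ncard hsub (Set.toFinite _)) (u - t • x)
      (V.sub_mem hu (V.smul_mem _ (hSV x hxS))) hw rfl
    refine ⟨y, hyS, fun e he => ?_⟩
    have h1 : 0 < y e * (u e - t * x e) := by simpa using hy e he
    -- Because `|t * x e| ≤ |u e|`, the subtraction cannot reverse the sign of `u e`, so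
    -- conformality to the difference passes to `u`.
    have h2 := hle e
    by_contra h3
    push Not at h3
    rcases lt_or_gt_of_ne he with h | h
    · have a1 : 0 ≤ u e := by nlinarith
      have a2 : u e - t * x e < 0 := by nlinarith
      rw [abs_of_nonneg a1] at h2
      linarith [le_abs_self (t * x e)]
    · have a1 : u e ≤ 0 := by nlinarith
      have a2 : 0 < u e - t * x e := by nlinarith
      rw [abs_of_nonpos a1] at h2
      linarith [neg_abs_le (t * x e)]

/-- A form of Gordan's theorem of the alternative, with free coordinates `I` and sign-constrained
coordinates `J`. -/
theorem exists_mem_or_exists_orthogonal (V : Submodule ℝ (E → ℝ)) (I J : Set E) (F : E → ℝ)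
    (hIJ : Disjoint I J) (hF : ∀ e ∈ J, F e * F e = 1) :
    (∃ x ∈ V, x ≠ 0 ∧ (∀ e, e ∉ I → e ∉ J → x e = 0) ∧ ∀ e ∈ J, 0 ≤ F e * x e) ∨
    ∃ w : E → ℝ, (∀ x ∈ V, x ⬝ᵥ w = 0) ∧ (∀ e ∈ I, w e = 0) ∧ ∀ e ∈ J, 0 < F e * w e := by
  classical
  let T : Submodule ℝ (E → ℝ) :=
    V ⊔ { carrier := {x | ∀ e ∉ I, x e = 0}
          add_mem' := fun {a b} ha hb e he => by simp [ha e he, hb e he]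
          zero_mem' := fun e _ => rfl
          smul_mem' := fun c x hx e he => by simp [hx e he] }
  let s : E → E → ℝ := fun e e' => if e = e' then 1 else 0
  -- `K` is the simplex of normalized sign patterns on `J`. If it meets `T`, the first alternative
  -- holds; if not, a separating functional supplies `w`.
  let K : Set (E → ℝ) := convexHull ℝ ((fun e => F e • s e) '' J)
  have hK : K ⊆ {z | (∀ e ∉ J, z e = 0) ∧ (∀ e ∈ J, 0 ≤ F e * z e) ∧
      ∑ e, (if e ∈ J then F e * z e else 0) = 1} := by
    apply convexHull_min
    · rintro _ ⟨e, he, rfl⟩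
      refine ⟨fun e' he' => ?_, fun e' _ => ?_, ?_⟩
      · have : e ≠ e' := fun h => he' (h ▸ he)
        simp [s, this]
      · by_cases h : e = e'
        · subst h; simp [s, hF e he]
        · simp [s, h]
      · rw [Finset.sum_eq_single e]
        · simp [s, he, hF e he]
        · intro e' _ h; simp [s, h.symm]
        · simp
    · intro a ha b hb p q hp hq hpq
      refine ⟨fun e he => ?_, fun e he => ?_, ?_⟩
      · simp [ha.1 e he, hb.1 e he]
      · have h1 := mul_nonneg hp (ha.2.1 e he)
        have h2 := mul_nonneg hq (hb.2.1 e he)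
        simp only [Pi.add_apply, Pi.smul_apply, smul_eq_mul]
        linarith
      · have : ∀ e, (if e ∈ J then F e * (p • a + q • b) e else 0) =
            p * (if e ∈ J then F e * a e else 0) + q * (if e ∈ J then F e * b e else 0) := by
          intro e
          split_ifs
          · simp only [Pi.add_apply, Pi.smul_apply, smul_eq_mul]; ring
          · simp
        simp only [this, Finset.sum_add_distrib, ← Finset.mul_sum, ha.2.2, hb.2.2]
        linarith
  by_cases hdisj : Disjoint K (T : Set (E → ℝ))
  · right
    obtain ⟨f, a, b, hfa, hab, hfb⟩ := geometric_hahn_banach_compact_closed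
      (convex_convexHull ℝ _) ((J.toFinite.image (fun e => F e • s e)).isCompact_convexHull (𝕜 := ℝ))
      T.convex T.closed_of_finiteDimensional hdisj
    have hb : b < 0 := by simpa using hfb 0 T.zero_mem
    -- A linear functional bounded below on a subspace vanishes there.
    have hT : ∀ x ∈ T, f x = 0 := by
      intro x hx
      by_contra h
      have := hfb ((b / f x) • x) (T.smul_mem _ hx)
      rw [map_smul, smul_eq_mul, div_mul_cancel₀ _ h] at this
      exact lt_irrefl _ this
    have hf : ∀ x, f x = x ⬝ᵥ fun e => f (s e) := fun x => by
      simpa [dotProduct, s] using f.toLinearMap.pi_apply_eq_sum_univ x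
    refine ⟨fun e => -f (s e), fun x hx => ?_, fun e he => ?_, fun e he => ?_⟩
    · rw [show (fun e => -f (s e)) = -fun e => f (s e) from rfl, dotProduct_neg, ← hf,
        hT x (Submodule.mem_sup_left hx), neg_zero]
    · have : f (s e) = 0 := hT _ (Submodule.mem_sup_right fun e' he' => by
        have : e ≠ e' := fun h => he' (h ▸ he)
        simp [s, this])
      simpa using this
    · have : f (F e • s e) < a := hfa _ (subset_convexHull ℝ _ ⟨e, he, rfl⟩)
      rw [map_smul, smul_eq_mul] at this
      have h2 : 0 < F e * -f (s e) := by linarith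
      simpa using h2
  · left
    obtain ⟨z, hzK, hzT⟩ := Set.not_disjoint_iff.1 hdisj
    obtain ⟨x, hx, y, hy, rfl⟩ := Submodule.mem_sup.1 hzT
    have hy : ∀ e ∉ I, y e = 0 := hy
    obtain ⟨h1, h2, h3⟩ := hK hzK
    have hyJ : ∀ e ∈ J, y e = 0 := fun e he => hy e fun h => hIJ.le_bot ⟨h, he⟩
    refine ⟨x, hx, ?_, fun e hI hJ => ?_, fun e he => ?_⟩
    · rintro rfl
      rw [Finset.sum_eq_zero] at h3
      · exact zero_ne_one h3
      · intro e _
        split_ifs with he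
        · simp [hyJ e he]
        · rfl
    · simpa [hy e hI] using h1 e hJ
    · simpa [hyJ e he] using h2 e he

end Conformal

/-! ### Cauchy–Binet and the order of a cokernel -/

section CauchyBinet

variable {n E : Type*} [Fintype n] [DecidableEq n] [Fintype E]

/-- Multilinearity in the columns: `p` records which summand is picked from each column of the
product. -/
theorem det_mul_transpose_eq_sum {R : Type*} [CommRing R] (D : Matrix n E R) :
    (D * D.transpose).det = ∑ p : n → E, (D.submatrix id p).det * ∏ i, D i (p i) := by
  classical
  simp only [Matrix.det_apply', Matrix.mul_apply, Finset.prod_univ_sum, Finset.mul_sum,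
    Fintype.piFinset_univ, Finset.sum_mul]
  rw [Finset.sum_comm]
  refine Finset.sum_congr rfl fun p _ => Finset.sum_congr rfl fun π _ => ?_
  simp [Finset.prod_mul_distrib, mul_assoc]

/-- The Cauchy–Binet formula for the Gram determinant of an integer matrix whose maximal minors are
`0` or `±1`: it counts the nonzero maximal minors. -/
theorem det_mul_transpose_eq_ncard (D : Matrix n E ℤ) (𝓑 : Set (Set E))
    (hcard : ∀ S ∈ 𝓑, S.ncard = Fintype.card n)
    (hone : ∀ p : n → E, Function.Injective p → Set.range p ∈ 𝓑 →
      (D.submatrix id p).det * (D.submatrix id p).det = 1)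
    (hzero : ∀ p : n → E, Set.range p ∉ 𝓑 → (D.submatrix id p).det = 0) :
    (D * D.transpose).det = 𝓑.ncard := by
  classical
  rw [det_mul_transpose_eq_sum, ← Finset.sum_fiberwise Finset.univ (fun p : n → E => Set.range p)]
  have key : ∀ S : Set E, (∑ p : n → E with Set.range p = S,
      (D.submatrix id p).det * ∏ i, D i (p i)) = if S ∈ 𝓑 then 1 else 0 := by
    intro S
    split_ifs with hS
    · obtain ⟨g⟩ : Nonempty (n ≃ S) := by
        rw [← Fintype.card_eq, ← hcard S hS, Set.ncard_eq_toFinset_card', Set.toFinset_card]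
      have hg : Function.Injective (fun i => (g i : E)) :=
        Subtype.val_injective.comp g.injective
      have hgS : Set.range (fun i => (g i : E)) = S := by
        ext e
        exact ⟨by rintro ⟨i, rfl⟩; exact (g i).2, fun he => ⟨g.symm ⟨e, he⟩, by simp⟩⟩
      rw [← hone _ hg (by rwa [hgS])]
      -- The functions with range `S` are the `g ∘ π` for permutations `π`. Expanding one factor of
      -- the squared minor, transposed, matches the sum term by term; the sign of `π` comes from
      -- permuting columns.
      have hsq : (D.submatrix id (fun i => (g i : E))).det * (D.submatrix id (fun i => (g i : E))).det
          = (D.submatrix id (fun i => (g i : E))).det *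
            (D.submatrix id (fun i => (g i : E))).transpose.det := by rw [Matrix.det_transpose]
      rw [hsq, Matrix.det_apply' (Matrix.transpose _), Finset.mul_sum]
      symm
      refine Finset.sum_bij (fun π _ i => (g (π i) : E)) ?_ ?_ ?_ ?_
      · intro π _
        simp only [Finset.mem_filter, Finset.mem_univ, true_and]
        exact (π.surjective.range_comp (fun i => (g i : E))).trans hgS
      · intro π _ π' _ h
        ext i
        exact hg (congrFun h i)
      · intro p hp
        simp only [Finset.mem_filter, Finset.mem_univ, true_and] at hp
        have hmem : ∀ i, p i ∈ S := fun i => hp ▸ Set.mem_range_self i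
        have hsurj : Function.Surjective (fun i => g.symm ⟨p i, hmem i⟩) := by
          intro j
          obtain ⟨i, hi⟩ : (g j : E) ∈ Set.range p := hp.symm ▸ (g j).2
          refine ⟨i, ?_⟩
          rw [Equiv.symm_apply_eq]
          exact Subtype.ext hi
        refine ⟨Equiv.ofBijective _ (Finite.surjective_iff_bijective.1 hsurj), Finset.mem_univ _, ?_⟩
        funext i
        simp
      · intro π _
        have : D.submatrix id (fun i => (g (π i) : E)) =
            (D.submatrix id (fun i => (g i : E))).submatrix id π := rfl
        rw [this, Matrix.det_permute']
        simp only [Matrix.transpose_apply, Matrix.submatrix_apply, id]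
        ring
    · refine Finset.sum_eq_zero fun p hp => ?_
      simp only [Finset.mem_filter, Finset.mem_univ, true_and] at hp
      rw [hzero p (hp ▸ hS), zero_mul]
  simp only [key, Finset.sum_boole]
  simp [Set.ncard_eq_toFinset_card', Set.toFinset]

theorem card_quotient_range_toLin' (P : Matrix n n ℤ) (hP : P.det ≠ 0) :
    Nat.card ((n → ℤ) ⧸ LinearMap.range (Matrix.toLin' P)) = P.det.natAbs := by
  have hinj : Function.Injective (Matrix.toLin' P) := by
    rw [← LinearMap.ker_eq_bot, Matrix.ker_toLin'_eq_bot_iff]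
    intro v hv
    by_contra h
    exact hP (Matrix.exists_mulVec_eq_zero_iff.1 ⟨v, h, hv⟩)
  rw [← Submodule.natAbs_det_equiv _ (LinearEquiv.ofInjective (Matrix.toLin' P) hinj),
    ← LinearMap.det_toLin']
  rfl

end CauchyBinet

end RegularMatroid

set_option linter.unusedSectionVars false

namespace RegularMatroid

/-! ### Cycle and cocycle spaces as orthogonal complements -/

section Orthogonality

variable {E R : Type*} [Fintype E] [Fintype R]

/-- The cycle space, as the kernel of the representing matrix. -/
abbrev cycleSpace (A : Matrix R E ℝ) : Submodule ℝ (E → ℝ) := LinearMap.ker A.mulVecLin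

/-- The cocycle space, as the row space of the representing matrix. -/
abbrev cocycleSpace (A : Matrix R E ℝ) : Submodule ℝ (E → ℝ) :=
  LinearMap.range A.transpose.mulVecLin

variable {A : Matrix R E ℝ} {M : Matroid E}

theorem mem_cycleSpace {x : E → ℝ} : x ∈ cycleSpace A ↔ A.mulVec x = 0 := Iff.rfl

theorem mem_cocycleSpace {w : E → ℝ} :
    w ∈ cocycleSpace A ↔ ∃ y : R → ℝ, A.transpose.mulVec y = w := Iff.rfl

theorem dotProduct_eq_zero {x w : E → ℝ} (hx : x ∈ cycleSpace A) (hw : w ∈ cocycleSpace A) :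
    x ⬝ᵥ w = 0 := by
  obtain ⟨y, rfl⟩ := hw
  rw [Matrix.mulVecLin_apply, Matrix.mulVec_transpose, dotProduct_comm,
    ← Matrix.dotProduct_mulVec, mem_cycleSpace.1 hx, dotProduct_zero]

theorem mem_cycleSpace_of_dotProduct {x : E → ℝ} (h : ∀ w ∈ cocycleSpace A, x ⬝ᵥ w = 0) :
    x ∈ cycleSpace A := by
  classical
  rw [mem_cycleSpace]
  funext r
  have := h _ (mem_cocycleSpace.2 ⟨Pi.single r 1, rfl⟩)
  rwa [Matrix.mulVec_transpose, dotProduct_comm, ← Matrix.dotProduct_mulVec,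
    single_one_dotProduct] at this

theorem mem_cocycleSpace_of_dotProduct {w : E → ℝ} (h : ∀ x ∈ cycleSpace A, x ⬝ᵥ w = 0) :
    w ∈ cocycleSpace A := by
  classical
  let f : (E → ℝ) →ₗ[ℝ] ℝ :=
    { toFun := fun x => x ⬝ᵥ w
      map_add' := fun a b => add_dotProduct a b w
      map_smul' := fun c a => smul_dotProduct c a w }
  -- A functional that kills the kernel of `A` factors through `A`; the coordinates of the factor
  -- give the row combination `y`.
  have hmem : f ∈ (LinearMap.ker A.mulVecLin).dualAnnihilator :=
    (Submodule.mem_dualAnnihilator f).2 h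
  rw [← LinearMap.range_dualMap_eq_dualAnnihilator_ker] at hmem
  obtain ⟨g, hg⟩ := hmem
  let y : R → ℝ := fun r => g fun r' => if r = r' then 1 else 0
  have hgy : ∀ z, g z = z ⬝ᵥ y := fun z => by
    simpa [dotProduct, y] using g.pi_apply_eq_sum_univ z
  refine mem_cocycleSpace.2 ⟨y, ?_⟩
  have hx : ∀ x : E → ℝ, x ⬝ᵥ A.transpose.mulVec y = x ⬝ᵥ w := by
    intro x
    have h1 : f x = g (A.mulVec x) := by rw [← hg]; rfl
    rw [show x ⬝ᵥ w = f x from rfl, h1, hgy, Matrix.mulVec_transpose, dotProduct_comm,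
      ← Matrix.dotProduct_mulVec, dotProduct_comm]
  funext e
  simpa using hx (Pi.single e 1)

/-- The support of a nonzero vector of the cycle space is dependent. -/
theorem not_indep_support (hM : Represents A M) {x : E → ℝ} (hx : x ∈ cycleSpace A)
    (hx0 : x ≠ 0) : ¬ M.Indep (Function.support x) := by
  intro hind
  rw [hM.2, linearIndepOn_iff] at hind
  refine hx0 ?_
  have := hind (Finsupp.equivFunOnFinite.symm x)
    (by rw [Finsupp.mem_supported]; intro e; simp) ?_
  · have h2 := congrArg Finsupp.equivFunOnFinite this
    rw [Equiv.apply_symm_apply] at h2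
    rw [h2]; rfl
  · rw [Finsupp.linearCombination_apply, Finsupp.sum_fintype _ _ (by simp)]
    funext r
    have := congrFun (mem_cycleSpace.1 hx) r
    simpa [Matrix.mulVec, dotProduct, Finset.sum_apply, mul_comm] using this

end Orthogonality

/-! ### Signed circuits and cocircuits inside cycles and cocycles -/

section Signatures

variable {E R : Type*} [Fintype E] [Fintype R] {A : Matrix R E ℝ} {M : Matroid E}

theorem IsSignedCircuit.ne_zero {x : E → ℝ} (hx : IsSignedCircuit M A x) : x ≠ 0 :=
  Function.support_nonempty_iff.1 hx.2.2.nonempty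

theorem IsSignedCocircuit.ne_zero {x : E → ℝ} (hx : IsSignedCocircuit M A x) : x ≠ 0 :=
  Function.support_nonempty_iff.1 hx.2.2.nonempty

theorem IsSignedCircuit.neg {x : E → ℝ} (hx : IsSignedCircuit M A x) :
    IsSignedCircuit M A (-x) := by
  refine ⟨fun e => ?_, by rw [Matrix.mulVec_neg, hx.2.1, neg_zero], ?_⟩
  · rcases hx.1 e with h | h | h <;> simp [h]
  · rw [Function.support_neg]; exact hx.2.2

theorem IsSignedCocircuit.neg {x : E → ℝ} (hx : IsSignedCocircuit M A x) :
    IsSignedCocircuit M A (-x) := by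
  obtain ⟨y, hy⟩ := hx.2.1
  refine ⟨fun e => ?_, ⟨-y, by rw [Matrix.mulVec_neg, hy]⟩, ?_⟩
  · rcases hx.1 e with h | h | h <;> simp [h]
  · rw [Function.support_neg]; exact hx.2.2

theorem CircuitSignature.neg_notMem (σ : CircuitSignature M A) {x : E → ℝ}
    (hx : x ∈ Set.range σ.choice) : -x ∉ Set.range σ.choice := by
  obtain ⟨C, rfl⟩ := hx
  rintro ⟨C', h⟩
  have : C = C' := by
    apply Subtype.ext
    rw [← σ.support_eq C, ← σ.support_eq C', h, Function.support_neg]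
  subst this
  exact (σ.isSignedCircuit C).ne_zero (self_eq_neg.1 h)

theorem CocircuitSignature.neg_notMem (σ' : CocircuitSignature M A) {x : E → ℝ}
    (hx : x ∈ Set.range σ'.choice) : -x ∉ Set.range σ'.choice := by
  obtain ⟨C, rfl⟩ := hx
  rintro ⟨C', h⟩
  have : C = C' := by
    apply Subtype.ext
    rw [← σ'.support_eq C, ← σ'.support_eq C', h, Function.support_neg]
  subst this
  exact (σ'.isSignedCocircuit C).ne_zero (self_eq_neg.1 h)

/-- A vector of the cocycle space that vanishes on a basis is zero. -/
theorem eq_zero_of_cocycleSpace (hM : Represents A M) (σ : CircuitSignature M A)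
    {w : E → ℝ} (hw : w ∈ cocycleSpace A) {B : Set E} (hB : M.IsBase B)
    (h : ∀ e ∈ B, w e = 0) : w = 0 := by
  funext e
  by_cases he : e ∈ B
  · exact h e he
  let C : {C : Set E // M.IsCircuit C} :=
    ⟨M.fundCircuit e B, hB.fundCircuit_isCircuit (hM.1 ▸ Set.mem_univ e) he⟩
  have hsupp := σ.support_eq C
  have hxe : σ.choice C e ≠ 0 := by
    rw [← Function.mem_support, hsupp]
    exact M.mem_fundCircuit e B
  have h0 := dotProduct_eq_zero (mem_cycleSpace.2 (σ.isSignedCircuit C).2.1) hw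
  rw [dotProduct, Finset.sum_eq_single e] at h0
  · exact (mul_eq_zero.1 h0).resolve_left hxe
  · intro f _ hfe
    by_cases hf : σ.choice C f = 0
    · simp [hf]
    · have : f ∈ M.fundCircuit e B := hsupp.subset (Function.mem_support.2 hf)
      rw [h f ((M.fundCircuit_subset_insert e B this).resolve_left hfe), mul_zero]
  · simp

/-- The support of a nonzero cycle is dependent, so it contains a circuit, on which `σ` supplies a
signed circuit. -/
theorem exists_conformal_isSignedCircuit (hM : Represents A M) (σ : CircuitSignature M A)
    {u : E → ℝ} (hu : u ∈ cycleSpace A) (hu0 : u ≠ 0) :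
    ∃ x, IsSignedCircuit M A x ∧ ∀ e, x e ≠ 0 → 0 < x e * u e := by
  refine exists_conformal (cycleSpace A) {x | IsSignedCircuit M A x} (fun x hx => hx.neg)
    (fun x hx => hx.ne_zero) (fun x hx => hx.2.1) (fun v hv hv0 => ?_) u hu hu0
  have hdep : M.Dep (Function.support v) :=
    ⟨not_indep_support hM hv hv0, hM.1 ▸ Set.subset_univ _⟩
  obtain ⟨C, hCv, hC⟩ := hdep.exists_isCircuit_subset
  exact ⟨_, σ.isSignedCircuit ⟨C, hC⟩, by rwa [σ.support_eq]⟩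

theorem exists_conformal_isSignedCocircuit (hM : Represents A M) (σ : CircuitSignature M A)
    (σ' : CocircuitSignature M A) {u : E → ℝ} (hu : u ∈ cocycleSpace A) (hu0 : u ≠ 0) :
    ∃ x, IsSignedCocircuit M A x ∧ ∀ e, x e ≠ 0 → 0 < x e * u e := by
  refine exists_conformal (cocycleSpace A) {x | IsSignedCocircuit M A x} (fun x hx => hx.neg)
    (fun x hx => hx.ne_zero) (fun x hx => hx.2.1) (fun v hv hv0 => ?_) u hu hu0
  have hmeet : ∀ B, M.IsBase B → (Function.support v ∩ B).Nonempty := by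
    intro B hB
    by_contra h
    refine hv0 (eq_zero_of_cocycleSpace hM σ hv hB fun e he => ?_)
    by_contra hve
    exact h ⟨e, hve, he⟩
  -- Cocircuits are the minimal sets meeting every basis.
  obtain ⟨D, hDv, hD⟩ := (Set.toFinite
    {X : Set E | ∀ B, M.IsBase B → (X ∩ B).Nonempty}).exists_le_minimal hmeet
  exact ⟨_, σ'.isSignedCocircuit ⟨D, Matroid.isCocircuit_iff_minimal.2 hD⟩,
    by rwa [σ'.support_eq]⟩

end Signatures

/-! ### Oriented bases and 0/1 coordinates of orientations -/

section Bases

variable {E R : Type*} [Fintype E] [Fintype R] {A : Matrix R E ℝ} {M : Matroid E}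

theorem CircuitSignature.mem_externalBasis (σ : CircuitSignature M A) (hM : Represents A M)
    {B : Set E} (hB : M.IsBase B) {e : E} (he : e ∉ B) :
    ∃ s : ℤˣ, ∀ t, (e, t) ∈ σ.externalBasis B ↔ t = s := by
  let C : {C : Set E // M.IsCircuit C} :=
    ⟨M.fundCircuit e B, hB.fundCircuit_isCircuit (hM.1 ▸ Set.mem_univ e) he⟩
  have hxe : σ.choice C e ≠ 0 := by
    rw [← Function.mem_support, σ.support_eq C]
    exact M.mem_fundCircuit e B
  have key : ∀ t, (e, t) ∈ σ.externalBasis B ↔ σ.choice C e = ((t : ℤ) : ℝ) := by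
    intro t
    constructor
    · rintro (h | ⟨_, C', hC', h⟩)
      · exact (he h).elim
      · obtain rfl : C' = C := Subtype.ext hC'
        exact h
    · exact fun h => Or.inr ⟨he, C, rfl, h⟩
  obtain ⟨s, hs⟩ : ∃ s : ℤˣ, σ.choice C e = ((s : ℤ) : ℝ) := by
    rcases (σ.isSignedCircuit C).1 e with h | h | h
    · exact (hxe h).elim
    · exact ⟨1, by simp [h]⟩
    · exact ⟨-1, by simp [h]⟩
  refine ⟨s, fun t => ?_⟩
  rw [key, hs, Int.cast_inj, Units.val_inj, eq_comm]

theorem CocircuitSignature.mem_internalBasis (σ' : CocircuitSignature M A)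
    {B : Set E} (hB : M.IsBase B) {e : E} (he : e ∈ B) :
    ∃ s : ℤˣ, ∀ t, (e, t) ∈ σ'.internalBasis B ↔ t = s := by
  let C : {C : Set E // M.IsCocircuit C} :=
    ⟨M.fundCocircuit e B, Matroid.fundCocircuit_isCocircuit he hB⟩
  have hxe : σ'.choice C e ≠ 0 := by
    rw [← Function.mem_support, σ'.support_eq C]
    exact M.mem_fundCocircuit e B
  have key : ∀ t, (e, t) ∈ σ'.internalBasis B ↔ σ'.choice C e = ((t : ℤ) : ℝ) := by
    intro t
    constructor
    · rintro (h | ⟨_, C', hC', h⟩)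
      · exact (h he).elim
      · obtain rfl : C' = C := Subtype.ext hC'
        exact h
    · exact fun h => Or.inr ⟨he, C, rfl, h⟩
  obtain ⟨s, hs⟩ : ∃ s : ℤˣ, σ'.choice C e = ((s : ℤ) : ℝ) := by
    rcases (σ'.isSignedCocircuit C).1 e with h | h | h
    · exact (hxe h).elim
    · exact ⟨1, by simp [h]⟩
    · exact ⟨-1, by simp [h]⟩
  refine ⟨s, fun t => ?_⟩
  rw [key, hs, Int.cast_inj, Units.val_inj, eq_comm]

theorem isOrientation_BBY (hM : Represents A M) (σ : CircuitSignature M A)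
    (σ' : CocircuitSignature M A) {B : Set E} (hB : M.IsBase B) :
    IsOrientation (BBY σ σ' B) := by
  intro e
  by_cases he : e ∈ B
  · obtain ⟨s, hs⟩ := σ'.mem_internalBasis hB he
    exact ⟨s, ⟨Or.inl he, (hs s).2 rfl⟩, fun t ht => (hs t).1 ht.2⟩
  · obtain ⟨s, hs⟩ := σ.mem_externalBasis hM hB he
    exact ⟨s, ⟨(hs s).2 rfl, Or.inl he⟩, fun t ht => (hs t).1 ht.1⟩

/-- The indicator vector of the positively directed arcs of an orientation. -/
noncomputable def positivePart (O : Set (Arc E)) (e : E) : ℤ := by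
  classical exact if (e, 1) ∈ O then 1 else 0

theorem IsOrientation.mem_neg_one_iff {O : Set (Arc E)} (hO : IsOrientation O) (e : E) :
    (e, (-1 : ℤˣ)) ∈ O ↔ (e, (1 : ℤˣ)) ∉ O := by
  obtain ⟨s, hs, hu⟩ := hO e
  constructor
  · intro h1 h2
    have := (hu _ h1).trans (hu _ h2).symm
    exact absurd this (by decide)
  · intro h
    rcases Int.units_eq_one_or s with rfl | rfl
    · exact (h hs).elim
    · exact hs

theorem IsOrientation.mem_iff {O : Set (Arc E)} (hO : IsOrientation O) (e : E) (s : ℤˣ) :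
    (e, s) ∈ O ↔ (s : ℤ) = 2 * positivePart O e - 1 := by
  rcases Int.units_eq_one_or s with rfl | rfl
  · by_cases h : (e, (1 : ℤˣ)) ∈ O <;> simp [positivePart, h]
  · rw [hO.mem_neg_one_iff]
    by_cases h : (e, (1 : ℤˣ)) ∈ O <;> simp [positivePart, h]

theorem positivePart_eq_zero_or_one (O : Set (Arc E)) (e : E) :
    positivePart O e = 0 ∨ positivePart O e = 1 := by
  unfold positivePart
  split_ifs <;> simp

end Bases

end RegularMatroid

namespace RegularMatroid

/-! ### Compatibility and injectivity of BBY -/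

section Bijection

variable {E R : Type*} [Fintype E] [Fintype R] {A : Matrix R E ℝ} {M : Matroid E}

theorem BBY_mem_compatible (hM : Represents A M) {σ : CircuitSignature M A}
    {σ' : CocircuitSignature M A} (hσ : σ.IsTriangulating) (hσ' : σ'.IsTriangulating)
    {B : Set E} (hB : M.IsBase B) :
    IsOrientation (BBY σ σ' B) ∧ σ.Compatible (BBY σ σ' B) ∧ σ'.Compatible (BBY σ σ' B) :=
  ⟨isOrientation_BBY hM σ σ' hB,
    fun x hx hxO => hσ B hB x hx (hxO.trans Set.inter_subset_left),
    fun x hx hxO => hσ' B hB x hx (hxO.trans Set.inter_subset_right)⟩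

theorem BBY_injOn (hM : Represents A M) {σ : CircuitSignature M A}
    {σ' : CocircuitSignature M A} (hσ : σ.IsTriangulating) (hσ' : σ'.IsTriangulating) :
    Set.InjOn (BBY σ σ') {B : Set E | M.IsBase B} := by
  classical
  intro B₁ hB₁ B₂ hB₂ heq
  have hB₁ : M.IsBase B₁ := hB₁
  have hB₂ : M.IsBase B₂ := hB₂
  by_contra hne
  set O := BBY σ σ' B₁ with hO
  have hor : IsOrientation O := isOrientation_BBY hM σ σ' hB₁
  have hO₂ : O ⊆ BBY σ σ' B₂ := heq.subset
  let o : E → ℝ := fun e => 2 * (positivePart O e : ℝ) - 1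
  have ho : ∀ e (s : ℤˣ), o e = ((s : ℤ) : ℝ) → (e, s) ∈ O := by
    intro e s h
    rw [hor.mem_iff]
    have : ((s : ℤ) : ℝ) = ((2 * positivePart O e - 1 : ℤ) : ℝ) := by
      rw [← h]; push_cast; rfl
    exact_mod_cast this
  have hosq : ∀ e, o e * o e = 1 := by
    intro e
    rcases positivePart_eq_zero_or_one O e with h | h <;> norm_num [o, h]
  -- On `B₂ \ B₁` the sign `F` follows `O`, on `B₁ \ B₂` it opposes `O`. A circuit with these signs
  -- fits `B₁` and its negative fits `B₂`; for cocircuits the roles are exchanged.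
  let F : E → ℝ := fun e => if e ∈ B₁ then -o e else o e
  have hFsq : ∀ e, F e * F e = 1 := by
    intro e
    by_cases h : e ∈ B₁ <;> simp [F, h, hosq]
  let J : Set E := {e | ¬ (e ∈ B₁ ↔ e ∈ B₂)}
  have hJ : ∃ e, e ∈ J := by
    by_contra h
    push Not at h
    exact hne (Set.ext fun e => not_not.1 (h e))
  have hdisj : Disjoint (B₁ ∩ B₂) J :=
    Set.disjoint_left.2 fun e he hJ => hJ (iff_of_true he.1 he.2)
  -- a `{0, ±1}`-entry conformal to `u`, where `F * u ≥ 0`, is `0` or agrees with `F`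
  have hsign : ∀ (a u : ℝ) (e : E), (a = 0 ∨ a = 1 ∨ a = -1) → a ≠ 0 → 0 < a * u →
      0 ≤ F e * u → a = F e := by
    intro a u e ha ha0 hau hFu
    have hF := mul_self_eq_one_iff.1 (hFsq e)
    rcases ha with rfl | rfl | rfl
    · exact (ha0 rfl).elim
    · rcases hF with h | h
      · exact h.symm
      · rw [h] at hFu; linarith
    · rcases hF with h | h
      · rw [h] at hFu; linarith
      · exact h.symm
  have hs0 : ∀ s : ℤˣ, ((s : ℤ) : ℝ) ≠ 0 := fun s => by exact_mod_cast s.ne_zero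
  rcases exists_mem_or_exists_orthogonal (cycleSpace A) (B₁ ∩ B₂) J F hdisj
    (fun e _ => hFsq e) with ⟨u, hu, hu0, hoff, hon⟩ | ⟨u, hu, hoff, hon⟩
  · obtain ⟨c, hc, hcu⟩ := exists_conformal_isSignedCircuit hM σ hu hu0
    have hcJ : ∀ e, c e ≠ 0 → e ∈ J → c e = F e := fun e h0 he =>
      hsign _ _ e (hc.1 e) h0 (hcu e h0) (hon e he)
    have hcI : ∀ e, c e ≠ 0 → e ∉ B₁ ∩ B₂ → e ∈ J := by
      intro e h0 he
      by_contra heJ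
      have := hcu e h0
      rw [hoff e he heJ, mul_zero] at this
      exact lt_irrefl _ this
    refine σ.neg_notMem (hσ B₁ hB₁ c hc ?_) (hσ B₂ hB₂ (-c) hc.neg ?_)
    · rintro ⟨e, s⟩ (hes : c e = _)
      by_cases he : e ∈ B₁
      · exact Or.inl he
      · have h0 : c e ≠ 0 := hes ▸ hs0 s
        have := hcJ e h0 (hcI e h0 fun h => he h.1)
        exact (ho e s (by rw [← hes, this]; simp [F, he])).1
    · rintro ⟨e, s⟩ (hes : -c e = _)
      by_cases he : e ∈ B₂
      · exact Or.inl he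
      · have h0 : c e ≠ 0 := neg_ne_zero.1 (hes ▸ hs0 s)
        have heJ := hcI e h0 fun h => he h.2
        have he₁ : e ∈ B₁ := by
          by_contra h
          exact heJ (iff_of_false h he)
        have := hcJ e h0 heJ
        exact (hO₂ (ho e s (by rw [← hes, this]; simp [F, he₁]))).1
  · have hu0 : u ≠ 0 := by
      rintro rfl
      obtain ⟨e, he⟩ := hJ
      simpa using hon e he
    obtain ⟨c, hc, hcu⟩ := exists_conformal_isSignedCocircuit hM σ σ'
      (mem_cocycleSpace_of_dotProduct hu) hu0
    have hcJ : ∀ e, c e ≠ 0 → e ∈ J → c e = F e := fun e h0 he =>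
      hsign _ _ e (hc.1 e) h0 (hcu e h0) (hon e he).le
    have hcI : ∀ e, c e ≠ 0 → e ∉ B₁ ∩ B₂ := by
      intro e h0 he
      have := hcu e h0
      rw [hoff e he, mul_zero] at this
      exact lt_irrefl _ this
    refine σ'.neg_notMem (hσ' B₂ hB₂ c hc ?_) (hσ' B₁ hB₁ (-c) hc.neg ?_)
    · rintro ⟨e, s⟩ (hes : c e = _)
      by_cases he : e ∈ B₂
      · have h0 : c e ≠ 0 := hes ▸ hs0 s
        have he₁ : e ∉ B₁ := fun h => hcI e h0 ⟨h, he⟩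
        have := hcJ e h0 fun h => he₁ (h.2 he)
        exact (hO₂ (ho e s (by rw [← hes, this]; simp [F, he₁]))).2
      · exact Or.inl he
    · rintro ⟨e, s⟩ (hes : -c e = _)
      by_cases he : e ∈ B₁
      · have h0 : c e ≠ 0 := neg_ne_zero.1 (hes ▸ hs0 s)
        have := hcJ e h0 fun h => hcI e h0 ⟨he, h.1 he⟩
        exact (ho e s (by rw [← hes, this]; simp [F, he])).2
      · exact Or.inl he

/-! ### Counting compatible orientations by a lattice quotient -/

/-- `D` is the matrix of fundamental cocircuits of `B`, with each row normalized to be `1` at its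
own basis element. -/
def IsFundamentalMatrix (A : Matrix R E ℝ) {B : Set E} (D : Matrix B E ℤ) : Prop :=
  (∀ b, (fun e => (D b e : ℝ)) ∈ cocycleSpace A) ∧ ∀ b b' : B, (b = b' → D b b' = 1) ∧
    (b ≠ b' → D b b' = 0)

theorem exists_isFundamentalMatrix (σ' : CocircuitSignature M A) {B : Set E} (hB : M.IsBase B) :
    ∃ D : Matrix B E ℤ, IsFundamentalMatrix A D := by
  have key : ∀ b : B, ∃ d : E → ℤ, (fun e => (d e : ℝ)) ∈ cocycleSpace A ∧
      ∀ b' : B, (b = b' → d b' = 1) ∧ (b ≠ b' → d b' = 0) := by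
    intro b
    let C : {C : Set E // M.IsCocircuit C} :=
      ⟨M.fundCocircuit b B, Matroid.fundCocircuit_isCocircuit b.2 hB⟩
    obtain ⟨hval, hmem, -⟩ := σ'.isSignedCocircuit C
    have hsupp : Function.support (σ'.choice C) = M.fundCocircuit b B := σ'.support_eq C
    have hoff : ∀ b' : B, b ≠ b' → σ'.choice C b' = 0 := by
      intro b' hb
      by_contra h
      have h1 : (b' : E) ∈ M.fundCocircuit b B := hsupp.subset h
      have h2 : (b' : E) ∈ M.fundCocircuit b B ∩ B := ⟨h1, b'.2⟩
      rw [M.fundCocircuit_inter_eq b.2] at h2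
      exact hb (Subtype.ext h2).symm
    have hb0 : σ'.choice C b ≠ 0 := hsupp.superset (M.mem_fundCocircuit b B)
    -- Multiplying by the entry at `b`, which is `±1`, makes that entry `1` and keeps the row
    -- integral.
    have hint : ∀ e, ∃ z : ℤ, (z : ℝ) = σ'.choice C b * σ'.choice C e := by
      intro e
      rcases hval b with h | h | h <;> rcases hval e with h' | h' | h' <;> rw [h, h']
      exacts [⟨0, by simp⟩, ⟨0, by simp⟩, ⟨0, by simp⟩, ⟨0, by simp⟩, ⟨1, by simp⟩,
        ⟨-1, by simp⟩, ⟨0, by simp⟩, ⟨-1, by simp⟩, ⟨1, by simp⟩]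
    choose d hd using hint
    refine ⟨d, ?_, fun b' => ⟨?_, fun hb => ?_⟩⟩
    · have : (fun e => (d e : ℝ)) = σ'.choice C b • σ'.choice C := funext hd
      rw [this]
      exact Submodule.smul_mem _ _ hmem
    · rintro rfl
      have : (d b : ℝ) = 1 := by
        rw [hd]
        rcases hval b with h | h | h
        · exact (hb0 h).elim
        · simp [h]
        · simp [h]
      exact_mod_cast this
    · have : (d b' : ℝ) = 0 := by rw [hd, hoff b' hb, mul_zero]
      exact_mod_cast this
  choose d hd1 hd2 using key
  exact ⟨d, hd1, hd2⟩

variable {B : Set E} [Fintype B] {D : Matrix B E ℤ}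

/-- A cocycle is the combination of the rows of a fundamental matrix given by its values on the
basis. -/
theorem IsFundamentalMatrix.expand (hD : IsFundamentalMatrix A D) (hM : Represents A M)
    (σ : CircuitSignature M A) (hB : M.IsBase B) {w : E → ℝ} (hw : w ∈ cocycleSpace A) (e : E) :
    w e = ∑ b : B, w b * D b e := by
  have h : w - ∑ b : B, w b • (fun e => (D b e : ℝ)) = 0 := by
    refine eq_zero_of_cocycleSpace hM σ (Submodule.sub_mem _ hw
      (Submodule.sum_mem _ fun b _ => Submodule.smul_mem _ _ (hD.1 b))) hB fun e he => ?_
    rw [Pi.sub_apply, Finset.sum_apply, Finset.sum_eq_single ⟨e, he⟩]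
    · simp [(hD.2 ⟨e, he⟩ ⟨e, he⟩).1 rfl]
    · intro b _ hb
      simp [(hD.2 b ⟨e, he⟩).2 hb]
    · simp
  have := congrFun h e
  simpa [sub_eq_zero, Finset.sum_apply] using this

theorem IsFundamentalMatrix.mem_cycleSpace_of_mulVec (hD : IsFundamentalMatrix A D) (hM : Represents A M)
    (σ : CircuitSignature M A) (hB : M.IsBase B) {u : E → ℤ} (hu : D.mulVec u = 0) :
    (fun e => (u e : ℝ)) ∈ cycleSpace A := by
  refine mem_cycleSpace_of_dotProduct fun w hw => ?_
  have hexp : (fun e => (u e : ℝ)) ⬝ᵥ w = ∑ e, ∑ b : B, (u e : ℝ) * (w b * D b e) :=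
    Finset.sum_congr rfl fun e _ => by
      rw [hD.expand hM σ hB hw e, Finset.mul_sum]
  rw [hexp, Finset.sum_comm]
  refine Finset.sum_eq_zero fun b _ => ?_
  have h := congrFun hu b
  have h' : ((∑ e, D b e * u e : ℤ) : ℝ) = 0 := by
    rw [show ∑ e, D b e * u e = 0 from h]; simp
  push_cast at h'
  calc ∑ e, (u e : ℝ) * (w b * D b e) = w b * ∑ e, (D b e : ℝ) * u e := by
        rw [Finset.mul_sum]; exact Finset.sum_congr rfl fun e _ => by ring
    _ = 0 := by rw [h', mul_zero]

/-- Minors on bases are units, since the fundamental matrix of another basis inverts the change of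
basis over `ℤ`. All others vanish, by a circuit among the columns or a repeated column. -/
theorem IsFundamentalMatrix.det_mul_transpose [DecidableEq B] (hD : IsFundamentalMatrix A D)
    (hM : Represents A M) (σ : CircuitSignature M A) (σ' : CocircuitSignature M A)
    (hB : M.IsBase B) :
    (D * D.transpose).det = {B : Set E | M.IsBase B}.ncard := by
  have hBcard : B.ncard = Fintype.card B := by
    rw [← Nat.card_coe_set_eq, Nat.card_eq_fintype_card]
  refine det_mul_transpose_eq_ncard D _
    (fun S hS => (Matroid.IsBase.ncard_eq_ncard_of_isBase hS hB).trans hBcard)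
    (fun p hp hS => ?_) (fun p hS => ?_)
  · classical
    have hS : M.IsBase (Set.range p) := hS
    obtain ⟨D', hD'⟩ := exists_isFundamentalMatrix σ' hS
    let N : Matrix B B ℤ := fun i j => D' ⟨p i, Set.mem_range_self i⟩ j
    have hN : N * D.submatrix id p = 1 := by
      ext i k
      have h := hD.expand hM σ hB (hD'.1 ⟨p i, Set.mem_range_self i⟩) (p k)
      have h' : D' ⟨p i, Set.mem_range_self i⟩ (p k) = (N * D.submatrix id p) i k := by
        rw [Matrix.mul_apply]
        exact_mod_cast h
      rw [← h', Matrix.one_apply]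
      have h2 := hD'.2 ⟨p i, Set.mem_range_self i⟩ ⟨p k, Set.mem_range_self k⟩
      split_ifs with hik
      · exact h2.1 (by subst hik; rfl)
      · exact h2.2 fun h => hik (hp (Subtype.ext_iff.1 h))
    have hdet := congrArg Matrix.det hN
    rw [Matrix.det_mul, Matrix.det_one] at hdet
    have hunit : IsUnit (D.submatrix id p).det := IsUnit.of_mul_eq_one_right _ hdet
    exact Int.isUnit_mul_self hunit
  · by_cases hp : Function.Injective p
    · have hdep : ¬ M.Indep (Set.range p) := by
        intro hI
        obtain ⟨B', hB', hsub⟩ := hI.exists_isBase_superset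
        refine hS ?_
        have : Set.range p = B' := by
          refine Set.eq_of_subset_of_ncard_le hsub ?_ (Set.toFinite _)
          rw [hB'.ncard_eq_ncard_of_isBase hB, hBcard, ← Nat.card_coe_set_eq,
            Nat.card_range_of_injective hp, Nat.card_eq_fintype_card]
        exact this ▸ hB'
      have hdep : M.Dep (Set.range p) := ⟨hdep, hM.1 ▸ Set.subset_univ _⟩
      obtain ⟨C, hCp, hC⟩ := hdep.exists_isCircuit_subset
      have hx := σ.isSignedCircuit ⟨C, hC⟩
      have hsupp : Function.support (σ.choice ⟨C, hC⟩) = C := σ.support_eq ⟨C, hC⟩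
      set x := σ.choice ⟨C, hC⟩
      have hker : ((D.submatrix id p).map (Int.castRingHom ℝ)).det = 0 := by
        rw [← Matrix.exists_mulVec_eq_zero_iff]
        refine ⟨x ∘ p, fun h => ?_, funext fun b => ?_⟩
        · obtain ⟨e, he⟩ := hC.nonempty
          obtain ⟨i, rfl⟩ := hCp he
          exact (hsupp.superset he) (congrFun h i)
        · have h0 := dotProduct_eq_zero (mem_cycleSpace.2 hx.2.1) (hD.1 b)
          have : ∑ i, x (p i) * (D b (p i) : ℝ) = ∑ e, x e * (D b e : ℝ) := by
            refine Finset.sum_of_injOn p hp.injOn (by simp) (fun e _ he => ?_) (fun _ _ => rfl)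
            have : x e = 0 := by
              by_contra h
              exact he (by simpa using hCp (hsupp.subset h))
            rw [this, zero_mul]
          rw [Pi.zero_apply, ← h0]
          simp only [dotProduct, ← this, Matrix.mulVec, Matrix.map_apply, Matrix.submatrix_apply,
            id, Function.comp, eq_intCast]
          exact Finset.sum_congr rfl fun i _ => mul_comm _ _
      rw [← RingHom.mapMatrix_apply, ← RingHom.map_det] at hker
      simpa using hker
    · rw [Function.Injective] at hp
      push Not at hp
      obtain ⟨i, j, hij, hne⟩ := hp
      exact Matrix.det_zero_of_column_eq hne fun b => by simp [hij]

/-- Distinct compatible orientations are not circuit-cocircuit equivalent. -/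
theorem IsFundamentalMatrix.compatible_injOn [DecidableEq B] (hD : IsFundamentalMatrix A D)
    (hM : Represents A M) (σ : CircuitSignature M A) (σ' : CocircuitSignature M A)
    (hB : M.IsBase B) :
    Set.InjOn (fun O : Set (Arc E) => (LinearMap.range (Matrix.toLin' (D * D.transpose))).mkQ
      (D.mulVec (positivePart O)))
      {O | IsOrientation O ∧ σ.Compatible O ∧ σ'.Compatible O} := by
  rintro O₁ ⟨hO₁, hσ₁, hσ₁'⟩ O₂ ⟨hO₂, hσ₂, hσ₂'⟩ h
  simp only [Submodule.mkQ_apply] at h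
  rw [Submodule.Quotient.eq, ← Matrix.mulVec_sub] at h
  obtain ⟨z, hz⟩ := h
  rw [Matrix.toLin'_apply] at hz
  set x : E → ℤ := positivePart O₁ - positivePart O₂ with hx
  let v : E → ℤ := D.transpose.mulVec z
  let u : E → ℤ := x - v
  have hu : (fun e => (u e : ℝ)) ∈ cycleSpace A := by
    apply hD.mem_cycleSpace_of_mulVec hM σ hB
    rw [Matrix.mulVec_sub, Matrix.mulVec_mulVec, hz, sub_self]
  have hv : (fun e => (v e : ℝ)) ∈ cocycleSpace A := by
    have : (fun e => (v e : ℝ)) = ∑ b : B, (z b : ℝ) • fun e => (D b e : ℝ) := by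
      funext e
      simp [v, Matrix.mulVec, dotProduct, Finset.sum_apply, mul_comm]
    rw [this]
    exact Submodule.sum_mem _ fun b _ => Submodule.smul_mem _ _ (hD.1 b)
  have hxval : ∀ e, x e = 0 ∨ x e = 1 ∨ x e = -1 := by
    intro e
    rcases positivePart_eq_zero_or_one O₁ e with h | h <;>
      rcases positivePart_eq_zero_or_one O₂ e with h' | h' <;> simp [hx, h, h']
  -- Integrality is essential: `u * (x - u) ≤ 0` for integers `u` when `x` is `0` or `±1`.
  -- Orthogonality then forces every product to vanish.
  have hle : ∀ e, u e * v e ≤ 0 := by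
    intro e
    have hvu : v e = x e - u e := by simp [u]
    rw [hvu]
    rcases hxval e with h | h | h <;> rw [h]
    · nlinarith [mul_self_nonneg (u e)]
    · rcases le_or_gt (u e) 0 with h' | h' <;> nlinarith
    · rcases lt_or_ge (u e) 0 with h' | h' <;> nlinarith
  have hsum : ∑ e, u e * v e = 0 := by
    have := dotProduct_eq_zero hu hv
    simp only [dotProduct] at this
    exact_mod_cast this
  have huv : ∀ e, u e * v e = 0 := fun e =>
    (Finset.sum_eq_zero_iff_of_nonpos fun e _ => hle e).1 hsum e (Finset.mem_univ e)
  have hxuv : ∀ e, x e = u e + v e := by intro e; simp [u]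
  -- a vector conformal to `x` lies in `O₁`, and its negative in `O₂`
  have harcs : ∀ c : E → ℝ, (∀ e, c e = 0 ∨ c e = 1 ∨ c e = -1) →
      (∀ e, c e ≠ 0 → 0 < c e * x e) → arcs c ⊆ O₁ ∧ arcs (-c) ⊆ O₂ := by
    intro c hc hcx
    have key : ∀ e, ∀ s : ℤˣ, c e = ((s : ℤ) : ℝ) → (e, s) ∈ O₁ ∧ (e, -s) ∈ O₂ := by
      intro e s hs
      have h0 : c e ≠ 0 := by rw [hs]; exact_mod_cast s.ne_zero
      have hpos := hcx e h0
      rw [hs] at hpos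
      have hpos : 0 < (s : ℤ) * x e := by exact_mod_cast hpos
      rw [hO₁.mem_iff, hO₂.mem_iff]
      have hxe : x e = positivePart O₁ e - positivePart O₂ e := rfl
      rcases positivePart_eq_zero_or_one O₁ e with h | h <;>
        rcases positivePart_eq_zero_or_one O₂ e with h' | h' <;>
        rcases Int.units_eq_one_or s with rfl | rfl <;> rw [hxe, h, h'] at hpos <;>
        simp_all
    refine ⟨?_, ?_⟩
    · rintro ⟨e, s⟩ (hes : c e = _)
      exact (key e s hes).1
    · rintro ⟨e, s⟩ (hes : -c e = _)
      have := (key e (-s) (by rw [neg_eq_iff_eq_neg.1 hes]; simp)).2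
      rwa [neg_neg] at this
  have hu0 : (fun e => (u e : ℝ)) = 0 := by
    by_contra hne
    obtain ⟨c, hc, hcu⟩ := exists_conformal_isSignedCircuit hM σ hu hne
    obtain ⟨h1, h2⟩ := harcs c hc.1 fun e he => by
      have h := hcu e he
      have hue : u e ≠ 0 := by
        intro h0
        simp [h0] at h
      rw [hxuv, (mul_eq_zero.1 (huv e)).resolve_left hue, add_zero]
      exact h
    exact σ.neg_notMem (hσ₁ c hc h1) (hσ₂ (-c) hc.neg h2)
  have hv0 : (fun e => (v e : ℝ)) = 0 := by
    by_contra hne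
    obtain ⟨c, hc, hcv⟩ := exists_conformal_isSignedCocircuit hM σ σ' hv hne
    obtain ⟨h1, h2⟩ := harcs c hc.1 fun e he => by
      have h := hcv e he
      have hve : v e ≠ 0 := by
        intro h0
        simp [h0] at h
      rw [hxuv, (mul_eq_zero.1 (huv e)).resolve_right hve, zero_add]
      exact h
    exact σ'.neg_notMem (hσ₁' c hc h1) (hσ₂' (-c) hc.neg h2)
  ext ⟨e, s⟩
  have h1 : u e = 0 := Int.cast_eq_zero.1 (congrFun hu0 e)
  have h2 : v e = 0 := Int.cast_eq_zero.1 (congrFun hv0 e)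
  have h3 : positivePart O₁ e = positivePart O₂ e := by
    have := hxuv e
    rw [h1, h2, hx, Pi.sub_apply] at this
    omega
  rw [hO₁.mem_iff, hO₂.mem_iff, h3]

theorem ncard_compatible_le (hM : Represents A M) (σ : CircuitSignature M A)
    (σ' : CocircuitSignature M A) :
    {O : Set (Arc E) | IsOrientation O ∧ σ.Compatible O ∧ σ'.Compatible O}.ncard ≤
      {B : Set E | M.IsBase B}.ncard := by
  classical
  obtain ⟨B, hB⟩ := M.exists_isBase
  obtain ⟨D, hD⟩ := exists_isFundamentalMatrix σ' hB
  have hdet := hD.det_mul_transpose hM σ σ' hB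
  have hpos : 0 < {B : Set E | M.IsBase B}.ncard := (Set.ncard_pos (Set.toFinite _)).2 ⟨B, hB⟩
  have hcard := card_quotient_range_toLin' (D * D.transpose) (by rw [hdet]; exact_mod_cast hpos.ne')
  rw [hdet, Int.natAbs_natCast] at hcard
  have : Finite ((B → ℤ) ⧸ LinearMap.range (Matrix.toLin' (D * D.transpose))) :=
    Nat.finite_of_card_ne_zero (hcard ▸ hpos.ne')
  rw [← hcard, ← Set.ncard_univ]
  exact Set.ncard_le_ncard_of_injOn _ (fun _ _ => Set.mem_univ _)
    (hD.compatible_injOn hM σ σ' hB) (Set.toFinite _)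

end Bijection

end RegularMatroid

theorem theorem1p15 {E R : Type*} [Fintype E] [Fintype R]
    (M : Matroid E) (A : Matrix R E ℝ)
    (hA : A.IsTotallyUnimodular) (hM : RegularMatroid.Represents A M)
    (σ : RegularMatroid.CircuitSignature M A) (σ' : RegularMatroid.CocircuitSignature M A)
    (hσ : σ.IsTriangulating) (hσ' : σ'.IsTriangulating) :
    Set.BijOn (RegularMatroid.BBY σ σ') {B : Set E | M.IsBase B}
      {O : Set (RegularMatroid.Arc E) |
        RegularMatroid.IsOrientation O ∧ σ.Compatible O ∧ σ'.Compatible O} := by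
  have hmaps : Set.MapsTo (RegularMatroid.BBY σ σ') {B : Set E | M.IsBase B}
      {O : Set (RegularMatroid.Arc E) |
        RegularMatroid.IsOrientation O ∧ σ.Compatible O ∧ σ'.Compatible O} :=
    fun _ hB => RegularMatroid.BBY_mem_compatible hM hσ hσ' hB
  have hinj := RegularMatroid.BBY_injOn hM hσ hσ'
  refine ⟨hmaps, hinj, ?_⟩
  -- The image has as many elements as there are bases, so the counting bound leaves no other
  -- compatible orientation.
  have himg := Set.eq_of_subset_of_ncard_le hmaps.image_subset
    ((RegularMatroid.ncard_compatible_le hM σ σ').trans hinj.ncard_image.ge)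
    (Set.toFinite _)
  exact himg.superset
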